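/- Conventions. Let $M$ be a Riemann surface with complex structure $J_M$, and let $W$ be a right quaternionic vector space of dimension $n+1$; a map $f\colon M\to\mathbb{P}(W)\cong\mathbb{HP}^n$ is identified with the line bundle $L\subset V:=M\times W$, $L_p=f(p)$. Let $\nabla$ be the trivial connection of $V$ and $*\omega(X)=\omega(J_MX)$ for 1-forms $\omega$. The map $f$ is a holomorphic curve if $L$ is a smooth subbundle and there is a smooth $J\in\Gamma(\mathrm{End}\,L)$ with $J^2=-1$ and $*\delta_L=\delta_LJ$, where $\delta_L=\pi_L\nabla|_L\in\Omega^1(\mathrm{Hom}(L,V/L))$ and $\pi_L\colon V\to V/L$ is the projection. A holomorphic curve $f$ is a Frenet curve with Frenet flag $(V_k)$ and canonical complex structure $S$ if (i) $L=V_0\subset V_1\subset\dots\subset V_n=V$ are smooth quaternionic subbundles on $M$ with $\operatorname{rank}V_k=k+1$ and $\nabla\Gamma(V_k)\subset\Omega^1(V_{k+1})$ for $0\le k<n$; (ii) $S$ is a smooth section of $\mathrm{End}(V)$ on $M$ with $S^2=-1$ which stabilizes every $V_k$, and $*\delta_k=S\delta_k=\delta_kS$ for $0\le k<n$, where $\delta_k=\pi_{V_k}\nabla|_{V_k}$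 is the derivative of $V_k$; (iii) $Q|_{V_{n-1}}=0$ (no condition if $n=0$), where $Q=\frac14(S\nabla S-*\nabla S)$ is the $(0,1)$-part in the type decomposition $\nabla S=2(*Q-*A)$; (iv) the set of Weierstrass points, that is, of the zeros of $\delta_0,\dots,\delta_{n-1}$, is closed and discrete in $M$. Theorem (a tangent curve of a Frenet curve is Frenet). Let $n\ge1$, let $f\colon M\to\mathbb{P}(W)\cong\mathbb{HP}^n$ be a Frenet curve with Frenet flag $(V_k)_{0\le k\le n}$ and canonical complex structure $S$, and let $H\subset W$ be a quaternionic hyperplane with $f(p)\not\subset H$ for all $p\in M$. Then $\tilde f(p)=(V_1)_p\cap H$ defines a map $\tilde f\colon M\to\mathbb{P}(H)\cong\mathbb{HP}^{n-1}$, which is again a Frenet curve. For every $p$ the projection $H\to W/L_p$ is bijective. The Frenet flag of $\tilde f$ is $\tilde V_k=V_{k+1}\cap H$, $0\le k\le n-1$, and its canonical complex structure is the $\tilde S$ on $M\times H$ that corresponds to the complex structure induced by $S$ on $V/L$ under this identification $H\cong V/L$. -/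

import Mathlib

open scoped Quaternion Manifold ContDiff Topology

/-! Quaternionic vector spaces are right vector spaces, that is, modules over `ℍ[ℝ]ᵐᵒᵖ`.
`M` is a Riemann surface (charts in `ℂ`), regarded as a real surface when smoothness and
derivatives are meant, and `W` is a finite dimensional quaternionic vector space; `V` of the
literature is the trivial bundle `M × W` with the trivial connection `∇`. -/

namespace QuatCurve

section Basic

variable {M : Type*} [TopologicalSpace M] [ChartedSpace ℂ M]
variable {W : Type*} [NormedAddCommGroup W] [NormedSpace ℝ W] [Module ℍ[ℝ]ᵐᵒᵖ W]

/-- The complex structure `J_M` of the Riemann surface on the tangent space at `p`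
(which Mathlib identifies with `ℂ` by the preferred chart at `p`). -/
def tangentJ (p : M) (X : TangentSpace 𝓘(ℝ, ℂ) p) : TangentSpace 𝓘(ℝ, ℂ) p :=
  (Complex.I * (show ℂ from X) : ℂ)

/-- The trivial connection `∇_X ψ` of a section `ψ` of the trivial bundle `M × W`. -/
noncomputable def nabla (ψ : M → W) (p : M) (X : TangentSpace 𝓘(ℝ, ℂ) p) : W :=
  mfderiv 𝓘(ℝ, ℂ) 𝓘(ℝ, W) ψ p X

/-- `E` is a smooth quaternionic subbundle of rank `r` of the trivial bundle `M × W`: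
it has smooth local frames. -/
def IsSmoothSubbundle (r : ℕ) (E : M → Submodule ℍ[ℝ]ᵐᵒᵖ W) : Prop :=
  ∀ p : M, ∃ U : Set M, IsOpen U ∧ p ∈ U ∧ ∃ e : Fin r → M → W,
    (∀ i, ContMDiffOn 𝓘(ℝ, ℂ) 𝓘(ℝ, W) ∞ (e i) U) ∧
    ∀ q ∈ U, LinearIndependent ℍ[ℝ]ᵐᵒᵖ (fun i => e i q) ∧
      Submodule.span ℍ[ℝ]ᵐᵒᵖ (Set.range fun i => e i q) = E q

/-- `ψ` is a smooth section of `E` over the open set `U` (its values off `U` are irrelevant). -/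
def IsSectionOn (U : Set M) (E : M → Submodule ℍ[ℝ]ᵐᵒᵖ W) (ψ : ∀ q, E q) : Prop :=
  IsOpen U ∧ ContMDiffOn 𝓘(ℝ, ℂ) 𝓘(ℝ, W) ∞ (fun q => (ψ q : W)) U

/-- `π_E ∇_X ψ` at `p`, where `π_E : M × W → (M × W) / E` is the canonical projection.
On sections `ψ` of `E` this is the derivative `δ_E` of `E`, evaluated at `X` and `ψ`. -/
noncomputable def bundleDeriv (E : M → Submodule ℍ[ℝ]ᵐᵒᵖ W) (ψ : M → W) (p : M)
    (X : TangentSpace 𝓘(ℝ, ℂ) p) : W ⧸ E p :=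
  (E p).mkQ (nabla ψ p X)

/-- The `(0,1)`-part `Q` in the type decomposition `∇S = 2(*Q - *A)` of the derivative of a
complex structure `S`, that is `Q = (S ∇S - *∇S) / 4`, evaluated at `X` and `v`.
As the constant section `v` is parallel, `(∇_X S) v = ∇_X (S v)`. -/
noncomputable def hopfQ (S : M → W →ₗ[ℍ[ℝ]ᵐᵒᵖ] W) (p : M) (X : TangentSpace 𝓘(ℝ, ℂ) p)
    (v : W) : W :=
  (1 / 4 : ℝ) • (S p (nabla (fun q => S q v) p X) - nabla (fun q => S q v) p (tangentJ p X))

/-- The map `f : M → P(W)`, given by the line bundle `L` with `L_p = f p`, is a holomorphic curve: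
it is smooth and there is a smooth section `J` of `End(L)` with `J² = -1` and `*δ_L = δ_L J`. -/
def IsHolomorphicCurve (f : M → Projectivization ℍ[ℝ]ᵐᵒᵖ W) : Prop :=
  IsSmoothSubbundle 1 (fun p => (f p).submodule) ∧
  ∃ J : ∀ p : M, (f p).submodule →ₗ[ℍ[ℝ]ᵐᵒᵖ] (f p).submodule,
    (∀ (U : Set M) (ψ : ∀ q, (f q).submodule), IsSectionOn U (fun q => (f q).submodule) ψ →
      IsSectionOn U (fun q => (f q).submodule) (fun q => J q (ψ q))) ∧
    (∀ p v, J p (J p v) = -v) ∧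
    ∀ (U : Set M) (ψ : ∀ q, (f q).submodule), IsSectionOn U (fun q => (f q).submodule) ψ →
      ∀ p ∈ U, ∀ X : TangentSpace 𝓘(ℝ, ℂ) p,
        bundleDeriv (fun q => (f q).submodule) (fun q => (ψ q : W)) p (tangentJ p X) =
          bundleDeriv (fun q => (f q).submodule) (fun q => (J q (ψ q) : W)) p X

/-- `L = V_0 ⊂ V_1 ⊂ … ⊂ V_n = M × W` is a smooth flag of quaternionic subbundles with
`rank V_k = k + 1` and `∇ Γ(V_k) ⊂ Ω¹(V_{k+1})`, where `L` is the line bundle of `f`. -/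
structure IsOsculatingFlag {n : ℕ} (f : M → Projectivization ℍ[ℝ]ᵐᵒᵖ W)
    (V : Fin (n + 1) → M → Submodule ℍ[ℝ]ᵐᵒᵖ W) : Prop where
  zero : ∀ p, V 0 p = (f p).submodule
  last : ∀ p, V (Fin.last n) p = ⊤
  bundle : ∀ k : Fin (n + 1), IsSmoothSubbundle (k.val + 1) (V k)
  le : ∀ (k : Fin n) (p : M), V k.castSucc p ≤ V k.succ p
  deriv : ∀ (k : Fin n) (U : Set M) (ψ : ∀ q, V k.castSucc q), IsSectionOn U (V k.castSucc) ψ →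
    ∀ p ∈ U, ∀ X : TangentSpace 𝓘(ℝ, ℂ) p, nabla (fun q => (ψ q : W)) p X ∈ V k.succ p

/-- `S` is a smooth complex structure on `M × W` that stabilizes the flag `V` and satisfies
`*δ_k = S δ_k = δ_k S` for the derivatives `δ_k` of `V_k`, `0 ≤ k < n`. -/
structure IsAdapted {n : ℕ} (V : Fin (n + 1) → M → Submodule ℍ[ℝ]ᵐᵒᵖ W)
    (S : M → W →ₗ[ℍ[ℝ]ᵐᵒᵖ] W) : Prop where
  smooth : ∀ v : W, ContMDiff 𝓘(ℝ, ℂ) 𝓘(ℝ, W) ∞ (fun p => S p v)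
  sq : ∀ (p : M) (v : W), S p (S p v) = -v
  stable : ∀ (k : Fin (n + 1)) (p : M), V k p ≤ (V k p).comap (S p)
  star_eq_left : ∀ (k : Fin n) (U : Set M) (ψ : ∀ q, V k.castSucc q),
    IsSectionOn U (V k.castSucc) ψ → ∀ p ∈ U, ∀ X : TangentSpace 𝓘(ℝ, ℂ) p,
      bundleDeriv (V k.castSucc) (fun q => (ψ q : W)) p (tangentJ p X) =
        (V k.castSucc p).mapQ (V k.castSucc p) (S p) (stable k.castSucc p)
          (bundleDeriv (V k.castSucc) (fun q => (ψ q : W)) p X)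
  star_eq_right : ∀ (k : Fin n) (U : Set M) (ψ : ∀ q, V k.castSucc q),
    IsSectionOn U (V k.castSucc) ψ → ∀ p ∈ U, ∀ X : TangentSpace 𝓘(ℝ, ℂ) p,
      bundleDeriv (V k.castSucc) (fun q => (ψ q : W)) p (tangentJ p X) =
        bundleDeriv (V k.castSucc) (fun q => S q (ψ q : W)) p X

/-- `S` is a canonical complex structure for the flag `V`: it is adapted and `Q` vanishes on
`V_{n-1}` (hence on all `V_k` with `k < n`; for `n = 0` there is no condition). -/
structure IsCanonical {n : ℕ} (V : Fin (n + 1) → M → Submodule ℍ[ℝ]ᵐᵒᵖ W)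
    (S : M → W →ₗ[ℍ[ℝ]ᵐᵒᵖ] W) : Prop extends IsAdapted V S where
  hopfQ_eq_zero : ∀ (k : Fin n) (p : M) (X : TangentSpace 𝓘(ℝ, ℂ) p),
    ∀ v ∈ V k.castSucc p, hopfQ S p X v = 0

/-- The Weierstrass points: the zeros of the flag derivatives `δ_k`, `0 ≤ k < n`. -/
def weierstrassPoints {n : ℕ} (V : Fin (n + 1) → M → Submodule ℍ[ℝ]ᵐᵒᵖ W) : Set M :=
  {p | ∃ k : Fin n, ∀ (U : Set M) (ψ : ∀ q, V k.castSucc q), IsSectionOn U (V k.castSucc) ψ →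
    p ∈ U → ∀ X : TangentSpace 𝓘(ℝ, ℂ) p,
      bundleDeriv (V k.castSucc) (fun q => (ψ q : W)) p X = 0}

/-- `f` is a Frenet curve with Frenet flag `V` and canonical complex structure `S`: a holomorphic
curve whose Weierstrass points form a closed discrete set and whose Frenet flag and
canonical complex structure are smooth on all of `M`. -/
structure IsFrenetWith {n : ℕ} (f : M → Projectivization ℍ[ℝ]ᵐᵒᵖ W)
    (V : Fin (n + 1) → M → Submodule ℍ[ℝ]ᵐᵒᵖ W) (S : M → W →ₗ[ℍ[ℝ]ᵐᵒᵖ] W) : Prop where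
  holomorphic : IsHolomorphicCurve f
  flag : IsOsculatingFlag f V
  canonical : IsCanonical V S
  discrete : (weierstrassPoints V)ᶜ ∈ Filter.codiscrete M

/-- `f : M → P(W)`, `dim W = n + 1`, is a Frenet curve. -/
def IsFrenetCurve (n : ℕ) (f : M → Projectivization ℍ[ℝ]ᵐᵒᵖ W) : Prop :=
  ∃ (V : Fin (n + 1) → M → Submodule ℍ[ℝ]ᵐᵒᵖ W) (S : M → W →ₗ[ℍ[ℝ]ᵐᵒᵖ] W), IsFrenetWith f V S

/-- The bundles `V_{k+1} ∩ H`, `0 ≤ k ≤ n`, regarded as subbundles of `M × H`. -/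
noncomputable def tangentFlag {n : ℕ} (V : Fin (n + 2) → M → Submodule ℍ[ℝ]ᵐᵒᵖ W)
    (H : Submodule ℍ[ℝ]ᵐᵒᵖ W) (k : Fin (n + 1)) (p : M) : Submodule ℍ[ℝ]ᵐᵒᵖ H :=
  (V k.succ p).comap H.subtype

end Basic

end QuatCurve

/-!
Every fibre of `L = V_0` is a complement of the hyperplane `H`, so projecting along `L` gives a
field of maps `P : W → H` which, under `H ≅ W / L`, is the canonical projection `W → W / L`. It is
smooth (`contMDiffAt_projAlong`), and the complex structure of the tangent curve is `S' = P S`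
(`inducedStructure`). Write `V'_k = V_{k+1} ∩ H`, and `δ'_k` for the derivative of `V'_k`.

Two facts carry the proof. First, `P ψ` differs from `ψ` by a section `l` of `L`, and
`∇ l` takes values in `V_1`; hence, modulo any `V_{k+1}`, sections can be replaced by their
projections before differentiating (`IsOsculatingFlag.nabla_sub_nabla_projAlong_mem`). As
`H / V'_k` embeds into `W / V_{k+1}`, this turns `*δ_{k+1} = S δ_{k+1} = δ_{k+1} S` into the same
equations for `δ'_k` and `S'`, and shows that a zero of `δ'_k` is a zero of `δ_{k+1}`. Secondly,
the Hopf fields of `S` and `S'` satisfy `Q' = P Q` on `H` (`hopfQ_inducedStructure`), because of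
`*δ_0 = S δ_0`; so the vanishing of `Q` on `V_{k+1}` gives that of `Q'` on `V'_k`.

The bundles `V'_k` are smooth because the projections of a frame of `V_{k+1}` span `V'_k`, and
finitely many vectors that are linearly independent over the quaternions stay so under small
perturbations (`isOpen_linearIndependent`).
-/

namespace QuatCurve

/-! ### Smooth maps into quaternionic vector spaces -/

section Smoothness

variable {M : Type*} [TopologicalSpace M] [ChartedSpace ℂ M]
variable {W : Type*} [NormedAddCommGroup W] [NormedSpace ℝ W]

theorem nabla_sub {ψ φ : M → W} {p : M} (hψ : ContMDiffAt 𝓘(ℝ, ℂ) 𝓘(ℝ, W) ∞ ψ p)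
    (hφ : ContMDiffAt 𝓘(ℝ, ℂ) 𝓘(ℝ, W) ∞ φ p) (X : TangentSpace 𝓘(ℝ, ℂ) p) :
    nabla (fun q => ψ q - φ q) p X = nabla ψ p X - nabla φ p X :=
  DFunLike.congr_fun (mfderiv_sub (hψ.mdifferentiableAt (by simp))
    (hφ.mdifferentiableAt (by simp))) X

variable [Module ℍ[ℝ]ᵐᵒᵖ W] [IsScalarTower ℝ ℍ[ℝ]ᵐᵒᵖ W]

variable (W) in
theorem smulCommClass_real : SMulCommClass ℍ[ℝ]ᵐᵒᵖ ℝ W :=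
  have := IsScalarTower.to_smulCommClass (R := ℝ) (A := ℍ[ℝ]ᵐᵒᵖ) (M := W)
  SMulCommClass.symm _ _ _

variable [Module.Finite ℍ[ℝ]ᵐᵒᵖ W]

variable (W) in
theorem finiteDimensional_real : FiniteDimensional ℝ W :=
  Module.Finite.trans ℍ[ℝ]ᵐᵒᵖ W

theorem contMDiffAt_linearMap_comp {F G : Type*} [NormedAddCommGroup F] [NormedSpace ℝ F]
    [FiniteDimensional ℝ F] [NormedAddCommGroup G] [NormedSpace ℝ G] (φ : F →ₗ[ℝ] G)
    {ψ : M → F} {p : M} (hψ : ContMDiffAt 𝓘(ℝ, ℂ) 𝓘(ℝ, F) ∞ ψ p) :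
    ContMDiffAt 𝓘(ℝ, ℂ) 𝓘(ℝ, G) ∞ (fun q => φ (ψ q)) p :=
  (LinearMap.toContinuousLinearMap φ).contDiff.contDiffAt.contMDiffAt.comp p hψ

theorem contMDiffAt_quaternion_smul {a : M → ℍ[ℝ]ᵐᵒᵖ} {ψ : M → W} {p : M}
    (ha : ContMDiffAt 𝓘(ℝ, ℂ) 𝓘(ℝ, ℍ[ℝ]ᵐᵒᵖ) ∞ a p)
    (hψ : ContMDiffAt 𝓘(ℝ, ℂ) 𝓘(ℝ, W) ∞ ψ p) :
    ContMDiffAt 𝓘(ℝ, ℂ) 𝓘(ℝ, W) ∞ (fun q => a q • ψ q) p := by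
  have := finiteDimensional_real W
  have := smulCommClass_real W
  have := IsScalarTower.to_smulCommClass (R := ℝ) (A := ℍ[ℝ]ᵐᵒᵖ) (M := W)
  let B : ℍ[ℝ]ᵐᵒᵖ →ₗ[ℝ] W →ₗ[ℝ] W := LinearMap.mk₂ ℝ (fun a v => a • v)
    (fun a b v => add_smul a b v) (fun r a v => smul_assoc r a v)
    (fun a v w => smul_add a v w) (fun r a v => smul_comm a r v)
  have hB : ContDiff ℝ ∞ fun x : ℍ[ℝ]ᵐᵒᵖ × W => x.1 • x.2 :=
    (LinearMap.toContinuousBilinearMap B).isBoundedBilinearMap.contDiff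
  exact hB.contDiffAt.contMDiffAt.comp p (ha.prodMk_space hψ)

theorem contMDiffAt_quaternion_inv {a : M → ℍ[ℝ]ᵐᵒᵖ} {p : M}
    (ha : ContMDiffAt 𝓘(ℝ, ℂ) 𝓘(ℝ, ℍ[ℝ]ᵐᵒᵖ) ∞ a p) (h0 : a p ≠ 0) :
    ContMDiffAt 𝓘(ℝ, ℂ) 𝓘(ℝ, ℍ[ℝ]ᵐᵒᵖ) ∞ (fun q => (a q)⁻¹) p := by
  have h := contDiffAt_ringInverse ℝ (n := ∞) (Units.mk0 (a p) h0)
  rw [Ring.inverse_eq_inv'] at h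
  exact h.contMDiffAt.comp p ha

/-- A field of endomorphisms that is smooth on constant sections is smooth on all smooth
sections. -/
theorem contMDiffAt_endo_apply {S : M → W →ₗ[ℍ[ℝ]ᵐᵒᵖ] W} {ψ : M → W} {p : M}
    (hS : ∀ v, ContMDiffAt 𝓘(ℝ, ℂ) 𝓘(ℝ, W) ∞ (fun q => S q v) p)
    (hψ : ContMDiffAt 𝓘(ℝ, ℂ) 𝓘(ℝ, W) ∞ ψ p) :
    ContMDiffAt 𝓘(ℝ, ℂ) 𝓘(ℝ, W) ∞ (fun q => S q (ψ q)) p := by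
  have := finiteDimensional_real W
  -- Expand `ψ` in a real basis: the coordinates are smooth functions, and `S q` is real linear.
  let b := Module.finBasis ℝ W
  have h : (fun q => S q (ψ q)) = fun q => ∑ i, b.coord i (ψ q) • S q (b i) := by
    funext q
    conv_lhs => rw [← b.sum_repr (ψ q)]
    simp only [map_sum, LinearMap.map_smul_of_tower, Module.Basis.coord_apply]
  rw [h]
  exact ContMDiffAt.sum fun i _ => (contMDiffAt_linearMap_comp _ hψ).smul (hS (b i))

/-- Quaternionic linear independence of finitely many vectors is injectivity of a real linear map
depending continuously on them, and injectivity is an open condition. -/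
theorem isOpen_linearIndependent (r : ℕ) :
    IsOpen {v : Fin r → W | LinearIndependent ℍ[ℝ]ᵐᵒᵖ v} := by
  have := finiteDimensional_real W
  have := smulCommClass_real W
  let T : (Fin r → W) →ₗ[ℝ] (Fin r → ℍ[ℝ]ᵐᵒᵖ) →L[ℝ] W :=
    { toFun v := LinearMap.toContinuousLinearMap
        ((Fintype.linearCombination ℍ[ℝ]ᵐᵒᵖ v).restrictScalars ℝ)
      map_add' v w := by
        ext x
        simp [Fintype.linearCombination_apply, Finset.sum_add_distrib]
      map_smul' c v := by
        ext x
        simp [Fintype.linearCombination_apply, Finset.smul_sum, smul_comm _ c] }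
  have hT : Continuous T := T.continuous_of_finiteDimensional
  convert ContinuousLinearMap.isOpen_injective.preimage hT using 1
  ext v
  exact linearIndependent_iff_injective_fintypeLinearCombination

theorem contMDiffAt_subtype_coe_iff {H : Submodule ℍ[ℝ]ᵐᵒᵖ W} {ψ : M → H} {p : M} :
    ContMDiffAt 𝓘(ℝ, ℂ) 𝓘(ℝ, W) ∞ (fun q => (ψ q : W)) p ↔
      ContMDiffAt 𝓘(ℝ, ℂ) 𝓘(ℝ, H) ∞ ψ p := by
  have := finiteDimensional_real W
  have := finiteDimensional_real H
  refine ⟨fun h => ?_, fun h => contMDiffAt_linearMap_comp (H.subtype.restrictScalars ℝ) h⟩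
  -- A fixed linear retraction `W → H` recovers `ψ` from its composite with the inclusion.
  obtain ⟨g, hg⟩ := H.subtype.exists_leftInverse_of_injective H.ker_subtype
  have hg' : ∀ x : H, g x = x := fun x => LinearMap.congr_fun hg x
  have h' := contMDiffAt_linearMap_comp (g.restrictScalars ℝ) h
  simpa [hg'] using h'

theorem nabla_coe {H : Submodule ℍ[ℝ]ᵐᵒᵖ W} {ψ : M → H} {p : M}
    (hψ : ContMDiffAt 𝓘(ℝ, ℂ) 𝓘(ℝ, H) ∞ ψ p) (X : TangentSpace 𝓘(ℝ, ℂ) p) :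
    nabla (fun q => (ψ q : W)) p X = (nabla ψ p X : H) := by
  have := finiteDimensional_real H
  let ι : H →L[ℝ] W := LinearMap.toContinuousLinearMap (H.subtype.restrictScalars ℝ)
  have h := mfderiv_comp p (ι.mdifferentiableAt (x := ψ p))
    (hψ.mdifferentiableAt (by simp))
  rw [ContinuousLinearMap.mfderiv_eq] at h
  exact DFunLike.congr_fun h X

end Smoothness

/-! ### Projection to a hyperplane along a line bundle -/

section Projection

variable {M : Type*}
variable {W : Type*} [NormedAddCommGroup W] [Module ℍ[ℝ]ᵐᵒᵖ W]
variable {H : Submodule ℍ[ℝ]ᵐᵒᵖ W} {L : M → Submodule ℍ[ℝ]ᵐᵒᵖ W}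

/-- The field of projections `W → H` along the line bundle `L`. Composed with `H ≅ W / L_p` it is
the canonical projection `W → W / L_p`. -/
noncomputable def projAlong (hc : ∀ p, IsCompl H (L p)) (p : M) : W →ₗ[ℍ[ℝ]ᵐᵒᵖ] H :=
  H.projectionOnto (L p) (hc p)

theorem projAlong_coe (hc : ∀ p, IsCompl H (L p)) (p : M) (h : H) : projAlong hc p h = h :=
  Submodule.projectionOnto_apply_left (hc p) h

theorem projAlong_eq_zero_iff (hc : ∀ p, IsCompl H (L p)) {p : M} {v : W} :
    projAlong hc p v = 0 ↔ v ∈ L p :=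
  Submodule.projectionOnto_apply_eq_zero_iff (hc p)

theorem sub_projAlong_mem (hc : ∀ p, IsCompl H (L p)) (p : M) (v : W) :
    v - projAlong hc p v ∈ L p := by
  rw [← projAlong_eq_zero_iff hc, map_sub, projAlong_coe, sub_self]

/-- A subspace containing `L_p` is stable under the projection along `L_p`. -/
theorem projAlong_mem_iff (hc : ∀ p, IsCompl H (L p)) {p : M} {E : Submodule ℍ[ℝ]ᵐᵒᵖ W}
    (hE : L p ≤ E) {v : W} : (projAlong hc p v : W) ∈ E ↔ v ∈ E := by
  have h := hE (sub_projAlong_mem hc p v)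
  exact ⟨fun hv => by simpa using E.add_mem h hv, fun hv => by simpa using E.sub_mem hv h⟩

theorem mkQ_projAlong (hc : ∀ p, IsCompl H (L p)) (p : M) (v : W) :
    (L p).mkQ (projAlong hc p v : W) = (L p).mkQ v :=
  ((Submodule.Quotient.eq _).2 (sub_projAlong_mem hc p v)).symm

theorem bijective_mkQ (hc : ∀ p, IsCompl H (L p)) (p : M) :
    Function.Bijective fun h : H => (L p).mkQ (h : W) := by
  refine ⟨fun h k hk => ?_, fun x => ?_⟩
  · have h0 := (projAlong_eq_zero_iff hc).2 ((Submodule.Quotient.eq _).1 hk)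
    rwa [map_sub, projAlong_coe, projAlong_coe, sub_eq_zero] at h0
  · obtain ⟨v, rfl⟩ := (L p).mkQ_surjective x
    exact ⟨projAlong hc p v, mkQ_projAlong hc p v⟩

theorem map_projAlong (hc : ∀ p, IsCompl H (L p)) {p : M} {E : Submodule ℍ[ℝ]ᵐᵒᵖ W}
    (hE : L p ≤ E) : E.map (projAlong hc p) = E.comap H.subtype := by
  ext h
  refine ⟨?_, fun hh => ⟨h, hh, projAlong_coe hc p h⟩⟩
  rintro ⟨v, hv, rfl⟩
  exact (projAlong_mem_iff hc hE).2 hv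

/-- The complex structure on `M × H` that corresponds to the one induced by `S` on `W / L` under
`H ≅ W / L`: apply `S`, then project back to `H` along `L`. -/
noncomputable def inducedStructure (hc : ∀ p, IsCompl H (L p))
    (S : M → W →ₗ[ℍ[ℝ]ᵐᵒᵖ] W) (p : M) : H →ₗ[ℍ[ℝ]ᵐᵒᵖ] H :=
  projAlong hc p ∘ₗ S p ∘ₗ H.subtype

theorem inducedStructure_apply (hc : ∀ p, IsCompl H (L p))
    (S : M → W →ₗ[ℍ[ℝ]ᵐᵒᵖ] W) (p : M) (h : H) :
    inducedStructure hc S p h = projAlong hc p (S p h) := rfl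

theorem isCompl_of_not_le [Module.Finite ℍ[ℝ]ᵐᵒᵖ W] {H L : Submodule ℍ[ℝ]ᵐᵒᵖ W} {n : ℕ}
    (hW : Module.finrank ℍ[ℝ]ᵐᵒᵖ W = n + 1) (hH : Module.finrank ℍ[ℝ]ᵐᵒᵖ H = n)
    (hL : Module.finrank ℍ[ℝ]ᵐᵒᵖ L = 1) (h : ¬ L ≤ H) : IsCompl H L := by
  have hlt : Module.finrank ℍ[ℝ]ᵐᵒᵖ H < Module.finrank ℍ[ℝ]ᵐᵒᵖ ↥(H ⊔ L) :=
    Submodule.finrank_lt_finrank_of_lt (left_lt_sup.2 h)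
  have hle := Submodule.finrank_le (H ⊔ L)
  have hadd := Submodule.finrank_sup_add_finrank_inf_eq H L
  refine IsCompl.of_eq (Submodule.finrank_eq_zero.1 (by omega))
    (Submodule.eq_top_of_finrank_eq (by omega))

/-- Intersecting a subspace that contains `L_p` with the hyperplane lowers its rank by one. -/
theorem finrank_comap_subtype [Module.Finite ℍ[ℝ]ᵐᵒᵖ W] {H L E : Submodule ℍ[ℝ]ᵐᵒᵖ W}
    (hc : IsCompl H L) (hE : L ≤ E) :
    Module.finrank ℍ[ℝ]ᵐᵒᵖ (E.comap H.subtype) + Module.finrank ℍ[ℝ]ᵐᵒᵖ L =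
      Module.finrank ℍ[ℝ]ᵐᵒᵖ E := by
  have hsup : H ⊔ E = ⊤ := eq_top_iff.2 (hc.sup_eq_top.symm.le.trans (sup_le_sup_left hE H))
  have h1 := Submodule.finrank_sup_add_finrank_inf_eq H E
  have h2 := Submodule.finrank_sup_add_finrank_inf_eq H L
  rw [hsup] at h1
  rw [hc.sup_eq_top, hc.inf_eq_bot, finrank_bot] at h2
  have h3 : Module.finrank ℍ[ℝ]ᵐᵒᵖ (E.comap H.subtype) = Module.finrank ℍ[ℝ]ᵐᵒᵖ ↥(H ⊓ E) := by
    rw [← Submodule.map_comap_subtype]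
    exact (Submodule.equivMapOfInjective _ H.subtype_injective _).finrank_eq
  omega

theorem exists_linearIndependent_comp_of_finrank_span_eq {K E ι : Type*} [DivisionRing K]
    [AddCommGroup E] [Module K E] [Finite ι] {v : ι → E} {r : ℕ}
    (h : Module.finrank K (Submodule.span K (Set.range v)) = r) :
    ∃ s : Fin r → ι, LinearIndependent K fun i => v (s i) := by
  subst h
  have := FiniteDimensional.span_of_finite K (Set.finite_range v)
  obtain ⟨b, hb, -, hbi⟩ := Submodule.exists_fun_fin_finrank_span_eq K (Set.range v)
  choose s hs using hb
  exact ⟨s, by simpa only [hs] using hbi⟩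

end Projection

section SmoothProjection

variable {M : Type*} [TopologicalSpace M] [ChartedSpace ℂ M]
variable {W : Type*} [NormedAddCommGroup W] [NormedSpace ℝ W] [Module ℍ[ℝ]ᵐᵒᵖ W]

theorem IsSmoothSubbundle.finrank_eq {r : ℕ} {E : M → Submodule ℍ[ℝ]ᵐᵒᵖ W}
    (hE : IsSmoothSubbundle r E) (p : M) : Module.finrank ℍ[ℝ]ᵐᵒᵖ (E p) = r := by
  obtain ⟨U, -, hp, e, -, he⟩ := hE p
  rw [← (he p hp).2, finrank_span_eq_card (he p hp).1, Fintype.card_fin]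

variable [IsScalarTower ℝ ℍ[ℝ]ᵐᵒᵖ W] [Module.Finite ℍ[ℝ]ᵐᵒᵖ W]
variable {H : Submodule ℍ[ℝ]ᵐᵒᵖ W} {L : M → Submodule ℍ[ℝ]ᵐᵒᵖ W}

/-- The projection along `L` is smooth: if the linear form `φ` vanishes on `H` and `e` is a local
frame of `L`, the component of `v` in `L` is `φ(v) φ(e)⁻¹` times `e`. -/
theorem contMDiffAt_projAlong (hc : ∀ p, IsCompl H (L p)) (hL : IsSmoothSubbundle 1 L)
    {ψ : M → W} {p : M} (hψ : ContMDiffAt 𝓘(ℝ, ℂ) 𝓘(ℝ, W) ∞ ψ p) :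
    ContMDiffAt 𝓘(ℝ, ℂ) 𝓘(ℝ, H) ∞ (fun q => projAlong hc q (ψ q)) p := by
  have := finiteDimensional_real W
  obtain ⟨U, hU, hp, e, he, hspan⟩ := hL p
  have hmem : ∀ q ∈ U, e 0 q ∈ L q := fun q hq =>
    (hspan q hq).2 ▸ Submodule.subset_span ⟨0, rfl⟩
  have hnot : e 0 p ∉ H := fun hH =>
    (hspan p hp).1.ne_zero 0 ((Submodule.disjoint_def.1 (hc p).disjoint) _ hH (hmem p hp))
  obtain ⟨φ, hφ, hker⟩ := Submodule.exists_le_ker_of_notMem hnot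
  have he0 : ContMDiffAt 𝓘(ℝ, ℂ) 𝓘(ℝ, W) ∞ (e 0) p := (he 0).contMDiffAt (hU.mem_nhds hp)
  have hφs : ∀ {χ : M → W}, ContMDiffAt 𝓘(ℝ, ℂ) 𝓘(ℝ, W) ∞ χ p →
      ContMDiffAt 𝓘(ℝ, ℂ) 𝓘(ℝ, ℍ[ℝ]ᵐᵒᵖ) ∞ (fun q => φ (χ q)) p := fun h =>
    contMDiffAt_linearMap_comp (φ.restrictScalars ℝ) h
  have hinv := contMDiffAt_quaternion_inv (hφs he0) hφ
  have key := hψ.sub (contMDiffAt_quaternion_smul (hφs hψ)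
    (contMDiffAt_quaternion_smul hinv he0))
  rw [← contMDiffAt_subtype_coe_iff]
  refine key.congr_of_eventuallyEq ?_
  have hne : ∀ᶠ q in 𝓝 p, φ (e 0 q) ≠ 0 := (hφs he0).continuousAt.eventually_ne hφ
  filter_upwards [hU.mem_nhds hp, hne] with q hq hneq
  have hl := sub_projAlong_mem hc q (ψ q)
  have hr : Set.range (fun i => e i q) = {e 0 q} := by
    rw [Set.range_unique]; rfl
  rw [← (hspan q hq).2, hr, Submodule.mem_span_singleton] at hl
  obtain ⟨c, hcq⟩ := hl
  have hP : φ (projAlong hc q (ψ q) : W) = 0 := hker (projAlong hc q (ψ q)).2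
  have hφc : c * φ (e 0 q) = φ (ψ q) := by
    rw [← smul_eq_mul, ← map_smul, hcq, map_sub, hP, sub_zero]
  change (projAlong hc q (ψ q) : W) = ψ q - φ (ψ q) • (φ (e 0 q))⁻¹ • e 0 q
  rw [← hφc, smul_smul, mul_assoc, mul_inv_cancel₀ hneq, mul_one, hcq, sub_sub_cancel]

/-- If `E ⊇ L` is a smooth subbundle of rank `r + 1`, then `E ∩ H` is one of rank `r`: the
projections of a local frame of `E` span `E ∩ H`, and those that form a basis at a point
still do so nearby. -/
theorem IsSmoothSubbundle.comap_subtype (hc : ∀ p, IsCompl H (L p)) (hL : IsSmoothSubbundle 1 L)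
    {r : ℕ} {E : M → Submodule ℍ[ℝ]ᵐᵒᵖ W} (hE : IsSmoothSubbundle (r + 1) E)
    (hLE : ∀ p, L p ≤ E p) : IsSmoothSubbundle r (fun p => (E p).comap H.subtype) := by
  intro p
  have hrank : ∀ q, Module.finrank ℍ[ℝ]ᵐᵒᵖ ((E q).comap H.subtype) = r := fun q => by
    have h := finrank_comap_subtype (hc q) (hLE q)
    rw [hE.finrank_eq, hL.finrank_eq] at h
    omega
  obtain ⟨U, hU, hp, e, he, hspan⟩ := hE p
  let g : Fin (r + 1) → M → H := fun i q => projAlong hc q (e i q)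
  have hgs : ∀ i, ∀ q ∈ U, ContMDiffAt 𝓘(ℝ, ℂ) 𝓘(ℝ, H) ∞ (g i) q := fun i q hq =>
    contMDiffAt_projAlong hc hL ((he i).contMDiffAt (hU.mem_nhds hq))
  have hgspan : ∀ q ∈ U, Submodule.span ℍ[ℝ]ᵐᵒᵖ (Set.range fun i => g i q) =
      (E q).comap H.subtype := fun q hq => by
    rw [← map_projAlong hc (hLE q), ← (hspan q hq).2, Submodule.map_span, ← Set.range_comp]
    rfl
  obtain ⟨s, hs⟩ := exists_linearIndependent_comp_of_finrank_span_eq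
    ((congrArg (fun F : Submodule ℍ[ℝ]ᵐᵒᵖ H => Module.finrank ℍ[ℝ]ᵐᵒᵖ F) (hgspan p hp)).trans
      (hrank p))
  have hcont : ContinuousAt (fun q i => g (s i) q) p :=
    continuousAt_pi.2 fun i => (hgs (s i) p hp).continuousAt
  obtain ⟨N, hN, hNo, hpN⟩ := eventually_nhds_iff.1
    (hcont.eventually ((isOpen_linearIndependent (W := H) r).mem_nhds hs))
  refine ⟨U ∩ N, hU.inter hNo, ⟨hp, hpN⟩, fun i => g (s i),
    fun i q hq => (hgs (s i) q hq.1).contMDiffWithinAt, fun q hq => ?_⟩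
  have hli : LinearIndependent ℍ[ℝ]ᵐᵒᵖ fun i => g (s i) q := hN q hq.2
  refine ⟨hli, Submodule.eq_of_le_of_finrank_eq ?_ ?_⟩
  · refine le_trans ?_ (hgspan q hq.1).le
    exact Submodule.span_mono (Set.range_subset_iff.2 fun i => ⟨s i, rfl⟩)
  · rw [finrank_span_eq_card hli, Fintype.card_fin]
    exact (hrank q).symm

end SmoothProjection

/-! ### The tangent curve -/

section TangentCurve

variable {M : Type*} [TopologicalSpace M] [ChartedSpace ℂ M]
variable {W : Type*} [NormedAddCommGroup W] [NormedSpace ℝ W] [Module ℍ[ℝ]ᵐᵒᵖ W]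
variable {n : ℕ} {V : Fin (n + 2) → M → Submodule ℍ[ℝ]ᵐᵒᵖ W}
  {f : M → Projectivization ℍ[ℝ]ᵐᵒᵖ W} {S : M → W →ₗ[ℍ[ℝ]ᵐᵒᵖ] W} {H : Submodule ℍ[ℝ]ᵐᵒᵖ W}

theorem IsOsculatingFlag.mono (hF : IsOsculatingFlag f V) (p : M) : Monotone fun k => V k p :=
  Fin.monotone_iff_le_succ.2 fun k => hF.le k p

theorem IsOsculatingFlag.zero_le (hF : IsOsculatingFlag f V) (k : Fin (n + 2)) (p : M) :
    V 0 p ≤ V k p :=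
  hF.mono p (Fin.zero_le k)

theorem IsOsculatingFlag.one_le_succ (hF : IsOsculatingFlag f V) (k : Fin (n + 1)) (p : M) :
    V 1 p ≤ V k.succ p :=
  hF.mono p (by simp [Fin.le_def])

/-- In terms of representatives, `*δ_k = S δ_k`. -/
theorem IsAdapted.sub_mem_left (hA : IsAdapted V S) (k : Fin (n + 1)) {U : Set M}
    {ψ : ∀ q, V k.castSucc q} (hψ : IsSectionOn U (V k.castSucc) ψ) {p : M} (hp : p ∈ U)
    (X : TangentSpace 𝓘(ℝ, ℂ) p) :
    nabla (fun q => (ψ q : W)) p (tangentJ p X) - S p (nabla (fun q => (ψ q : W)) p X) ∈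
      V k.castSucc p :=
  (Submodule.Quotient.eq _).1 (hA.star_eq_left k U ψ hψ p hp X)

/-- In terms of representatives, `*δ_k = δ_k S`. -/
theorem IsAdapted.sub_mem_right (hA : IsAdapted V S) (k : Fin (n + 1)) {U : Set M}
    {ψ : ∀ q, V k.castSucc q} (hψ : IsSectionOn U (V k.castSucc) ψ) {p : M} (hp : p ∈ U)
    (X : TangentSpace 𝓘(ℝ, ℂ) p) :
    nabla (fun q => (ψ q : W)) p (tangentJ p X) - nabla (fun q => S q (ψ q)) p X ∈
      V k.castSucc p :=
  (Submodule.Quotient.eq _).1 (hA.star_eq_right k U ψ hψ p hp X)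

variable [IsScalarTower ℝ ℍ[ℝ]ᵐᵒᵖ W] [Module.Finite ℍ[ℝ]ᵐᵒᵖ W]

theorem contMDiffAt_inducedStructure {L : M → Submodule ℍ[ℝ]ᵐᵒᵖ W}
    (hc : ∀ p, IsCompl H (L p)) (hL : IsSmoothSubbundle 1 L)
    (hS : ∀ v : W, ContMDiff 𝓘(ℝ, ℂ) 𝓘(ℝ, W) ∞ fun p => S p v) {ψ : M → H} {p : M}
    (hψ : ContMDiffAt 𝓘(ℝ, ℂ) 𝓘(ℝ, H) ∞ ψ p) :
    ContMDiffAt 𝓘(ℝ, ℂ) 𝓘(ℝ, H) ∞ (fun q => inducedStructure hc S q (ψ q)) p :=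
  contMDiffAt_projAlong hc hL (contMDiffAt_endo_apply (fun v => (hS v).contMDiffAt)
    (contMDiffAt_subtype_coe_iff.2 hψ))

/-- The `L`-component of a smooth map `ψ`, as a section of `L`. -/
theorem isSectionOn_sub_projAlong {L : M → Submodule ℍ[ℝ]ᵐᵒᵖ W} (hc : ∀ p, IsCompl H (L p))
    (hL : IsSmoothSubbundle 1 L) {U : Set M} (hU : IsOpen U) {ψ : M → W}
    (hψ : ContMDiffOn 𝓘(ℝ, ℂ) 𝓘(ℝ, W) ∞ ψ U) :
    IsSectionOn U L fun q => ⟨ψ q - projAlong hc q (ψ q), sub_projAlong_mem hc q (ψ q)⟩ :=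
  ⟨hU, fun _ hq =>
    have h := hψ.contMDiffAt (hU.mem_nhds hq)
    (h.sub (contMDiffAt_subtype_coe_iff.2 (contMDiffAt_projAlong hc hL h))).contMDiffWithinAt⟩

/-- As `∇Γ(L) ⊂ Ω¹(V_1)`, projecting a section along `L` changes its derivative only by
an element of `V_1`. -/
theorem IsOsculatingFlag.nabla_sub_nabla_projAlong_mem (hF : IsOsculatingFlag f V)
    (hc : ∀ p, IsCompl H (V 0 p)) {U : Set M} (hU : IsOpen U) {ψ : M → W}
    (hψ : ContMDiffOn 𝓘(ℝ, ℂ) 𝓘(ℝ, W) ∞ ψ U) {p : M} (hp : p ∈ U)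
    (X : TangentSpace 𝓘(ℝ, ℂ) p) :
    nabla ψ p X - (nabla (fun q => projAlong hc q (ψ q)) p X : H) ∈ V 1 p := by
  have hL : IsSmoothSubbundle 1 (V 0) := hF.bundle 0
  have h := hψ.contMDiffAt (hU.mem_nhds hp)
  have hP := contMDiffAt_projAlong hc hL h
  rw [← nabla_coe hP, ← nabla_sub h (contMDiffAt_subtype_coe_iff.2 hP)]
  exact hF.deriv 0 U _ (isSectionOn_sub_projAlong hc hL hU hψ) p hp X

theorem isSectionOn_of_tangentFlag {U : Set M} {k : Fin (n + 1)}
    {ψ : ∀ q, tangentFlag V H k q} (hψ : IsSectionOn U (tangentFlag V H k) ψ) :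
    IsSectionOn U (V k.succ) fun q => ⟨((ψ q : H) : W), (ψ q).2⟩ :=
  ⟨hψ.1, fun _ hq => (contMDiffAt_subtype_coe_iff.2
    (hψ.2.contMDiffAt (hψ.1.mem_nhds hq))).contMDiffWithinAt⟩

theorem IsSectionOn.nabla_coe {U : Set M} {E : M → Submodule ℍ[ℝ]ᵐᵒᵖ H}
    {ψ : ∀ q, E q} (hψ : IsSectionOn U E ψ) {p : M} (hp : p ∈ U)
    (X : TangentSpace 𝓘(ℝ, ℂ) p) :
    nabla (fun q => ((ψ q : H) : W)) p X = (nabla (fun q => (ψ q : H)) p X : H) :=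
  QuatCurve.nabla_coe (hψ.2.contMDiffAt (hψ.1.mem_nhds hp)) X

/-- The bundles `V_{k+1} ∩ H` form an osculating flag. -/
theorem IsOsculatingFlag.tangentFlag (hF : IsOsculatingFlag f V) (hc : ∀ p, IsCompl H (V 0 p))
    {f' : M → Projectivization ℍ[ℝ]ᵐᵒᵖ H}
    (hf' : ∀ p, (f' p).submodule = (V 1 p).comap H.subtype) :
    IsOsculatingFlag f' (tangentFlag V H) where
  zero p := (hf' p).symm
  last p := by
    change (V (Fin.last (n + 1)) p).comap H.subtype = ⊤
    rw [hF.last, Submodule.comap_top]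
  bundle k := IsSmoothSubbundle.comap_subtype hc (hF.bundle 0)
    (by simpa using hF.bundle k.succ) fun p => hF.zero_le _ p
  le k p := Submodule.comap_mono (hF.le k.succ p)
  deriv k U ψ hψ p hp X := by
    change ((nabla (fun q => (ψ q : H)) p X : H) : W) ∈ V k.succ.succ p
    rw [← hψ.nabla_coe hp]
    exact hF.deriv k.succ U _ (isSectionOn_of_tangentFlag hψ) p hp X

/-- `*δ'_k = δ'_k S'` for `0 ≤ k < n`. Modulo `V_{k+1}`, the section `S'ψ` has the same derivative
as `Sψ`. -/
theorem IsAdapted.tangent_sub_mem_right (hF : IsOsculatingFlag f V) (hA : IsAdapted V S)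
    (hc : ∀ p, IsCompl H (V 0 p)) (k : Fin n) {U : Set M}
    {ψ : ∀ q, tangentFlag V H k.castSucc q}
    (hψ : IsSectionOn U (tangentFlag V H k.castSucc) ψ) {p : M} (hp : p ∈ U)
    (X : TangentSpace 𝓘(ℝ, ℂ) p) :
    nabla (fun q => (ψ q : H)) p (tangentJ p X) -
      nabla (fun q => inducedStructure hc S q (ψ q)) p X ∈ tangentFlag V H k.castSucc p := by
  have hψW := isSectionOn_of_tangentFlag hψ
  have h1 := hA.sub_mem_right k.succ hψW hp X
  have hS : ContMDiffOn 𝓘(ℝ, ℂ) 𝓘(ℝ, W) ∞ (fun q => S q ((ψ q : H) : W)) U := fun q hq =>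
    (contMDiffAt_endo_apply (fun v => (hA.smooth v).contMDiffAt)
      (hψW.2.contMDiffAt (hψ.1.mem_nhds hq))).contMDiffWithinAt
  have h2 := hF.one_le_succ k.castSucc p
    (hF.nabla_sub_nabla_projAlong_mem hc hψ.1 hS hp X)
  have h3 := (V k.castSucc.succ p).add_mem h1 h2
  rw [hψ.nabla_coe hp, sub_add_sub_cancel] at h3
  exact h3

/-- `S'` is adapted to the flag of the tangent curve. -/
theorem IsAdapted.tangentFlag (hF : IsOsculatingFlag f V) (hA : IsAdapted V S)
    (hc : ∀ p, IsCompl H (V 0 p)) :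
    IsAdapted (tangentFlag V H) (inducedStructure hc S) where
  smooth v p := contMDiffAt_inducedStructure hc (hF.bundle 0) hA.smooth contMDiffAt_const
  sq p v := by
    -- `P S` kills the `L`-component of `S v`, as `S` stabilizes `L`.
    have h0 := hA.stable 0 p (sub_projAlong_mem hc p (S p v))
    rw [Submodule.mem_comap, ← projAlong_eq_zero_iff hc, map_sub, map_sub, hA.sq, map_neg,
      projAlong_coe] at h0
    exact (sub_eq_zero.1 h0).symm
  stable k p h hh := (projAlong_mem_iff hc (hF.zero_le _ p)).2 (hA.stable k.succ p hh)
  star_eq_left k U ψ hψ p hp X := by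
    refine (Submodule.Quotient.eq _).2 ?_
    have h1 := hA.sub_mem_left k.succ (isSectionOn_of_tangentFlag hψ) hp X
    rw [hψ.nabla_coe hp, hψ.nabla_coe hp] at h1
    have h2 := hF.zero_le k.succ.castSucc p
      (sub_projAlong_mem hc p (S p (nabla (fun q => (ψ q : H)) p X : H)))
    have h3 := (V k.succ.castSucc p).add_mem h1 h2
    rw [sub_add_sub_cancel] at h3
    exact h3
  star_eq_right k U ψ hψ p hp X :=
    (Submodule.Quotient.eq _).2 (hA.tangent_sub_mem_right hF hc k hψ hp X)

/-- On `H` the section `q ↦ S' h` differs from `q ↦ S h` by a section `l` of `L`, so that `4 Q' h`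
is the projection of `4 Q h + *∇l - S∇l`; the last two terms are in `L` because `*δ_0 = S δ_0`. -/
theorem hopfQ_inducedStructure (hF : IsOsculatingFlag f V) (hA : IsAdapted V S)
    (hc : ∀ p, IsCompl H (V 0 p)) (p : M) (X : TangentSpace 𝓘(ℝ, ℂ) p) (h : H) :
    hopfQ (inducedStructure hc S) p X h = projAlong hc p (hopfQ S p X h) := by
  have hL : IsSmoothSubbundle 1 (V 0) := hF.bundle 0
  have hS := hA.smooth h
  have hSp := hS.contMDiffAt (x := p)
  have hP := contMDiffAt_projAlong hc hL hSp
  have hl := hA.sub_mem_left 0 (isSectionOn_sub_projAlong hc hL isOpen_univ hS.contMDiffOn)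
    (Set.mem_univ p) X
  have hsub : ∀ Y : TangentSpace 𝓘(ℝ, ℂ) p,
      nabla (fun q => S q (h : W) - projAlong hc q (S q h)) p Y =
        nabla (fun q => S q (h : W)) p Y -
          (nabla (fun q => projAlong hc q (S q h)) p Y : H) := fun Y => by
    rw [nabla_sub hSp (contMDiffAt_subtype_coe_iff.2 hP), nabla_coe hP]
  have hl' := (projAlong_eq_zero_iff hc).2 hl
  simp only [hsub, map_sub, projAlong_coe] at hl'
  simp only [hopfQ, LinearMap.map_smul_of_tower, map_sub, inducedStructure_apply]
  congr 1
  rw [sub_eq_sub_iff_sub_eq_sub, ← sub_eq_zero, ← hl']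
  abel

/-- `S'` is a canonical complex structure of the flag of the tangent curve. -/
theorem IsCanonical.tangentFlag (hF : IsOsculatingFlag f V) (hC : IsCanonical V S)
    (hc : ∀ p, IsCompl H (V 0 p)) :
    IsCanonical (tangentFlag V H) (inducedStructure hc S) where
  toIsAdapted := hC.toIsAdapted.tangentFlag hF hc
  hopfQ_eq_zero k p X h hh := by
    rw [hopfQ_inducedStructure hF hC.toIsAdapted, hC.hopfQ_eq_zero k.succ p X h hh, map_zero]

/-- A zero of `δ'_k` is a zero of `δ_{k+1}`: modulo `V_{k+1}`, a section of `V_{k+1}` has the same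
derivative as its projection to `V_{k+1} ∩ H`. -/
theorem weierstrassPoints_tangentFlag_subset (hF : IsOsculatingFlag f V)
    (hc : ∀ p, IsCompl H (V 0 p)) :
    weierstrassPoints (tangentFlag V H) ⊆ weierstrassPoints V := by
  rintro p ⟨k, hk⟩
  refine ⟨k.succ, fun U ψ hψ hp X => (Submodule.Quotient.mk_eq_zero _).2 ?_⟩
  have hsec : IsSectionOn U (tangentFlag V H k.castSucc) fun q =>
      ⟨projAlong hc q (ψ q), (projAlong_mem_iff hc (hF.zero_le _ q)).2 (ψ q).2⟩ :=
    ⟨hψ.1, fun q hq => (contMDiffAt_projAlong hc (hF.bundle 0)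
      (hψ.2.contMDiffAt (hψ.1.mem_nhds hq))).contMDiffWithinAt⟩
  have h1 : ((nabla (fun q => projAlong hc q (ψ q)) p X : H) : W) ∈ V k.castSucc.succ p :=
    ((Submodule.Quotient.mk_eq_zero _).1 (hk U _ hsec hp X) :)
  have h2 := hF.one_le_succ k.castSucc p
    (hF.nabla_sub_nabla_projAlong_mem hc hψ.1 hψ.2 hp X)
  simpa using (V k.castSucc.succ p).add_mem h1 h2

/-- A line bundle with osculating flag and adapted complex structure is a holomorphic
curve: restrict the complex structure to the line. If `W` itself is a line, then `W / L = 0` and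
the condition on `δ_L` is empty. -/
theorem IsHolomorphicCurve.of_isAdapted {n : ℕ} {V : Fin (n + 1) → M → Submodule ℍ[ℝ]ᵐᵒᵖ W}
    (hF : IsOsculatingFlag f V) (hA : IsAdapted V S) : IsHolomorphicCurve f := by
  have h0 : V 0 = fun p => (f p).submodule := funext hF.zero
  have hstab : ∀ p, ∀ v ∈ (f p).submodule, S p v ∈ (f p).submodule := fun p v hv => by
    rw [← hF.zero] at hv ⊢
    exact hA.stable 0 p hv
  refine ⟨h0 ▸ hF.bundle 0, fun p => (S p).restrict (hstab p), fun U ψ hψ => ⟨hψ.1, fun q hq =>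
    (contMDiffAt_endo_apply (fun v => (hA.smooth v).contMDiffAt)
      (hψ.2.contMDiffAt (hψ.1.mem_nhds hq))).contMDiffWithinAt⟩,
    fun p v => Subtype.ext (hA.sq p v), fun U ψ hψ p hp X => ?_⟩
  refine (Submodule.Quotient.eq _).2 ?_
  rcases n with _ | n
  · have htop : (f p).submodule = ⊤ := by rw [← hF.zero, ← hF.last p]; rfl
    change _ ∈ (f p).submodule
    rw [htop]
    exact Submodule.mem_top
  · have hψ' : IsSectionOn U (V 0) fun q => ⟨(ψ q : W), (hF.zero q).symm ▸ (ψ q).2⟩ := hψ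
    change _ ∈ (f p).submodule
    rw [← hF.zero]
    exact hA.sub_mem_right 0 hψ' hp X

end TangentCurve

end QuatCurve

theorem mainTheorem5 {M : Type*} [TopologicalSpace M] [ChartedSpace ℂ M] [IsManifold 𝓘(ℂ) ω M]
    {W : Type*} [NormedAddCommGroup W] [NormedSpace ℝ W] [Module ℍ[ℝ]ᵐᵒᵖ W]
    [IsScalarTower ℝ ℍ[ℝ]ᵐᵒᵖ W]
    (n : ℕ) (hW : Module.finrank ℍ[ℝ]ᵐᵒᵖ W = n + 2)
    (f : M → Projectivization ℍ[ℝ]ᵐᵒᵖ W)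
    (V : Fin (n + 2) → M → Submodule ℍ[ℝ]ᵐᵒᵖ W) (S : M → W →ₗ[ℍ[ℝ]ᵐᵒᵖ] W)
    (hf : QuatCurve.IsFrenetWith f V S)
    (H : Submodule ℍ[ℝ]ᵐᵒᵖ W) (hH : Module.finrank ℍ[ℝ]ᵐᵒᵖ H = n + 1)
    (hfH : ∀ p, ¬ (f p).submodule ≤ H) :
    ∃ (f' : M → Projectivization ℍ[ℝ]ᵐᵒᵖ H) (S' : M → H →ₗ[ℍ[ℝ]ᵐᵒᵖ] H),
      (∀ p, (f' p).submodule = (V 1 p).comap H.subtype) ∧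
      (∀ p, Function.Bijective fun h : H => (V 0 p).mkQ (h : W)) ∧
      (∀ (p : M) (h : H), (V 0 p).mkQ (S' p h : W) =
        (V 0 p).mapQ (V 0 p) (S p) (hf.canonical.stable 0 p) ((V 0 p).mkQ (h : W))) ∧
      QuatCurve.IsFrenetCurve n f' ∧
      QuatCurve.IsFrenetWith f' (QuatCurve.tangentFlag V H) S' := by
  have : Module.Finite ℍ[ℝ]ᵐᵒᵖ W := Module.finite_of_finrank_pos (by omega)
  have hF := hf.flag
  have hc : ∀ p, IsCompl H (V 0 p) := fun p =>
    QuatCurve.isCompl_of_not_le hW hH ((hF.bundle 0).finrank_eq p) (hF.zero p ▸ hfH p)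
  have hrank : ∀ p, Module.finrank ℍ[ℝ]ᵐᵒᵖ ((V 1 p).comap H.subtype) = 1 := fun p => by
    have h := QuatCurve.finrank_comap_subtype (hc p) (hF.zero_le 1 p)
    rw [(hF.bundle 0).finrank_eq, (hF.bundle 1).finrank_eq] at h
    simpa using h
  let f' : M → Projectivization ℍ[ℝ]ᵐᵒᵖ H := fun p => Projectivization.mk'' _ (hrank p)
  have hf' : ∀ p, (f' p).submodule = (V 1 p).comap H.subtype := fun p =>
    Projectivization.submodule_mk'' _ (hrank p)
  have hF' := hF.tangentFlag hc hf'
  have hC' := hf.canonical.tangentFlag hF hc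
  have hfrenet : QuatCurve.IsFrenetWith f' (QuatCurve.tangentFlag V H)
      (QuatCurve.inducedStructure hc S) :=
    ⟨.of_isAdapted hF' hC'.toIsAdapted, hF', hC', Filter.mem_of_superset hf.discrete
      (Set.compl_subset_compl.2 (QuatCurve.weierstrassPoints_tangentFlag_subset hF hc))⟩
  exact ⟨f', QuatCurve.inducedStructure hc S, hf', QuatCurve.bijective_mkQ hc,
    fun p h => QuatCurve.mkQ_projAlong hc p (S p h), ⟨_, _, hfrenet⟩, hfrenet⟩
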